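/- Let $k$ be a field, let $n\ge 2$ be an integer, and let $\mathcal{C}$ be a skeletally small, $k$-linear, $\operatorname{Hom}$-finite, idempotent complete (hence Krull–Schmidt) triangulated category with suspension $\Sigma$. Let $\mathcal{T}\subseteq\mathcal{C}$ be an $n$-cluster tilting subcategory, that is, a functorially finite full subcategory, closed under isomorphisms, finite direct sums and direct summands, such that $$\mathcal{T}=\{X\in\mathcal{C} : \mathcal{C}(\mathcal{T},\Sigma^iX)=0 \text{ for } 1\le i\le n-1\}=\{X\in\mathcal{C} : \mathcal{C}(X,\Sigma^i\mathcal{T})=0 \text{ for } 1\le i\le n-1\}.$$ Let $K_0^{\mathrm{sp}}(-)$ denote the split Grothendieck group of an additive category, with classes $[-]^{\mathrm{sp}}$, and let $(\mathcal{C},\mathbb{E}_{\mathcal{T}},\mathfrak{s}_{\mathcal{T}})$ be the relative extriangulated category whose extriangles are given by the triangles $A\to B\to C\xrightarrow{\gamma}\Sigma A$ of $\mathcal{C}$ with $\gamma\circ\xi=0$ for all $\xi\colon T\to C$ with $T\in\mathcal{T}$. Its Grothendieck group $K_0(\mathcal{C},\mathbb{E}_{\mathcal{T}},\mathfrak{s}_{\mathcal{T}})$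 is the quotient of $K_0^{\mathrm{sp}}(\mathcal{C})$ by the subgroup generated by the elements $[A]^{\mathrm{sp}}-[B]^{\mathrm{sp}}+[C]^{\mathrm{sp}}$ for all these extriangles; write $[C]_{\mathcal{T}}$ for the class of $C$ in it. Then each $C\in\mathcal{C}$ admits a tower of triangles $V_{i+1}\to T_i\xrightarrow{\tau_i}V_i\to\Sigma V_{i+1}$ $(0\le i\le n-2)$ with $V_0=C$, $V_{n-1}=T_{n-1}$, all $T_i\in\mathcal{T}$ and each $\tau_i$ a minimal right $\mathcal{T}$-approximation; the element $$\operatorname{ind}_{\mathcal{T}}(C)=\sum_{i=0}^{n-1}(-1)^i[T_i]^{\mathrm{sp}}\in K_0^{\mathrm{sp}}(\mathcal{T})$$ (the triangulated index of $C$) does not depend on the choice of the tower, and it induces a surjective homomorphism $\operatorname{ind}_{\mathcal{T}}\colon K_0^{\mathrm{sp}}(\mathcal{C})\to K_0^{\mathrm{sp}}(\mathcal{T})$. Moreover, there is an isomorphism of abelian groups $$\Phi_{\mathcal{T}}\colon K_0(\mathcal{C},\mathbb{E}_{\mathcal{T}},\mathfrak{s}_{\mathcal{T}})\to K_0^{\mathrm{sp}}(\mathcal{T}),\qquad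 [C]_{\mathcal{T}}\mapsto\operatorname{ind}_{\mathcal{T}}(C),$$ whose composite with the canonical surjection $K_0^{\mathrm{sp}}(\mathcal{C})\to K_0(\mathcal{C},\mathbb{E}_{\mathcal{T}},\mathfrak{s}_{\mathcal{T}})$, $[C]^{\mathrm{sp}}\mapsto[C]_{\mathcal{T}}$, is $\operatorname{ind}_{\mathcal{T}}$, and whose inverse is given by $[T]^{\mathrm{sp}}\mapsto[T]_{\mathcal{T}}$ for $T\in\mathcal{T}$. -/

import Mathlib

open CategoryTheory CategoryTheory.Limits CategoryTheory.Pretriangulated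

universe w' w v u

noncomputable section

namespace ClusterIndex

/-! ### Split Grothendieck groups -/

section Split

variable (A : Type u) [Category.{v} A] [Preadditive A]

/-- The relations `[X ⊕ Y] - [X] - [Y]`, for all biproducts `X ⊕ Y` that exist in `A`, in the
free abelian group on the isomorphism classes of objects of `A`. -/
def splitRelations : AddSubgroup (FreeAbelianGroup (Quotient (isIsomorphicSetoid A))) :=
  AddSubgroup.closure
    {r | ∃ (X Y : A) (b : BinaryBicone X Y), Nonempty b.IsBilimit ∧
      r = FreeAbelianGroup.of (Quotient.mk _ b.pt) - FreeAbelianGroup.of (Quotient.mk _ X) -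
        FreeAbelianGroup.of (Quotient.mk _ Y)}

/-- The split Grothendieck group of an additive category. -/
def SplitK₀ : Type u :=
  FreeAbelianGroup (Quotient (isIsomorphicSetoid A)) ⧸ splitRelations A

instance : AddCommGroup (SplitK₀ A) :=
  inferInstanceAs (AddCommGroup
    (FreeAbelianGroup (Quotient (isIsomorphicSetoid A)) ⧸ splitRelations A))

variable {A}

/-- The class `[X]` of an object in the split Grothendieck group. -/
def SplitK₀.of (X : A) : SplitK₀ A :=
  QuotientAddGroup.mk' (splitRelations A) (FreeAbelianGroup.of (Quotient.mk _ X))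

end Split

/-! ### Additive subcategories and approximations -/

section Approximation

variable {C : Type u} [Category.{v} C] (T : ObjectProperty C)

/-- An additive subcategory: a full subcategory closed under isomorphisms, finite direct sums
and direct summands. -/
structure IsAdditiveSubcategory : Prop where
  closedUnderIso : T.IsClosedUnderIsomorphisms
  closedUnderSums : T.IsClosedUnderFiniteProducts
  closedUnderSummands : T.IsStableUnderRetracts

/-- `τ : Y ⟶ X` is a right `T`-approximation of `X`. -/
structure IsRightApprox {Y X : C} (τ : Y ⟶ X) : Prop where
  mem : T Y
  factors : ∀ (Y' : C), T Y' → ∀ f : Y' ⟶ X, ∃ g : Y' ⟶ Y, g ≫ τ = f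

/-- `σ : X ⟶ Y` is a left `T`-approximation of `X`. -/
structure IsLeftApprox {X Y : C} (σ : X ⟶ Y) : Prop where
  mem : T Y
  factors : ∀ (Y' : C), T Y' → ∀ f : X ⟶ Y', ∃ g : Y ⟶ Y', σ ≫ g = f

/-- A minimal right `T`-approximation: one that is moreover a right minimal morphism. -/
structure IsMinimalRightApprox {Y X : C} (τ : Y ⟶ X) : Prop extends IsRightApprox T τ where
  minimal : ∀ φ : Y ⟶ Y, φ ≫ τ = τ → IsIso φ

/-- Contravariantly finite subcategories. -/
def IsContravariantlyFinite : Prop :=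
  ∀ X : C, ∃ (Y : C) (τ : Y ⟶ X), IsRightApprox T τ

/-- Covariantly finite subcategories. -/
def IsCovariantlyFinite : Prop :=
  ∀ X : C, ∃ (Y : C) (σ : X ⟶ Y), IsLeftApprox T σ

/-- Functorially finite subcategories. -/
def IsFunctoriallyFinite : Prop :=
  IsContravariantlyFinite T ∧ IsCovariantlyFinite T

end Approximation

section Triangulated

variable {C : Type u} [Category.{v} C] [Preadditive C] [HasZeroObject C] [HasShift C ℤ]
  [∀ i : ℤ, (shiftFunctor C i).Additive] [Pretriangulated C]

/-! ### Cluster tilting -/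

/-- `n`-cluster tilting subcategories, with `Ext^i(X, Y) = Hom(X, Y⟦i⟧)`. -/
structure IsClusterTilting (n : ℕ) (T : ObjectProperty C) : Prop
    extends IsAdditiveSubcategory T where
  functoriallyFinite : IsFunctoriallyFinite T
  mem_iff_right : ∀ X : C, T X ↔
    ∀ i : ℕ, 1 ≤ i → i ≤ n - 1 → ∀ Y : C, T Y → ∀ f : Y ⟶ X⟦(i : ℤ)⟧, f = 0
  mem_iff_left : ∀ X : C, T X ↔
    ∀ i : ℕ, 1 ≤ i → i ≤ n - 1 → ∀ Y : C, T Y → ∀ f : X ⟶ Y⟦(i : ℤ)⟧, f = 0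

/-! ### The relative extriangulated structure -/

/-- The extensions `𝔼(Z, X) = Hom(Z, X⟦1⟧)` whose restriction to `T` vanishes. -/
def relExt (T : ObjectProperty C) (Z X : C) : AddSubgroup (Z ⟶ X⟦(1 : ℤ)⟧) where
  carrier := {δ | ∀ (Y : C), T Y → ∀ ξ : Y ⟶ Z, ξ ≫ δ = 0}
  zero_mem' := by intro Y _ ξ; simp
  add_mem' := by
    intro a b ha hb Y hY ξ
    rw [Preadditive.comp_add, ha Y hY ξ, hb Y hY ξ, add_zero]
  neg_mem' := by
    intro a ha Y hY ξ
    rw [Preadditive.comp_neg, ha Y hY ξ, neg_zero]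

set_option linter.unusedSectionVars false in
/-- `relExt T` is a subfunctor of `𝔼`. -/
theorem relExt_map_mem (T : ObjectProperty C) {Z Z' X X' : C} (γ : Z' ⟶ Z) (α : X ⟶ X')
    {δ : Z ⟶ X⟦(1 : ℤ)⟧} (hδ : δ ∈ relExt T Z X) :
    γ ≫ δ ≫ α⟦(1 : ℤ)⟧' ∈ relExt T Z' X' := by
  intro Y hY ξ
  have := hδ Y hY (ξ ≫ γ)
  rw [Category.assoc] at this
  rw [← Category.assoc γ, ← Category.assoc ξ, this, zero_comp]

/-- Three-term complexes `X ⟶ mid ⟶ Z` with fixed end terms. -/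
structure ThreeTerm (X Z : C) where
  mid : C
  f : X ⟶ mid
  g : mid ⟶ Z
  zero : f ≫ g = 0

/-- Equivalence of three-term complexes: an isomorphism of the middle terms compatible with the
identities of the end terms. -/
def threeTermSetoid (X Z : C) : Setoid (ThreeTerm X Z) where
  r a b := ∃ e : a.mid ≅ b.mid, a.f ≫ e.hom = b.f ∧ e.hom ≫ b.g = a.g
  iseqv :=
    { refl := fun a => ⟨Iso.refl _, by simp, by simp⟩
      symm := by
        rintro a b ⟨e, h₁, h₂⟩
        exact ⟨e.symm, by simp [← h₁], by simp [← h₂]⟩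
      trans := by
        rintro a b c ⟨e, h₁, h₂⟩ ⟨e', h₁', h₂'⟩
        exact ⟨e ≪≫ e', by simp [← h₁', ← h₁], by simp [← h₂, ← h₂']⟩ }

/-- Some complex that extends to a distinguished triangle with third morphism `δ`. -/
theorem exists_threeTerm {X Z : C} (δ : Z ⟶ X⟦(1 : ℤ)⟧) :
    ∃ a : ThreeTerm X Z, Triangle.mk a.f a.g δ ∈ distTriang C := by
  obtain ⟨Y, f, g, h⟩ := distinguished_cocone_triangle₂ δ
  exact ⟨⟨Y, f, g, comp_distTriang_mor_zero₁₂ _ h⟩, h⟩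

/-- The realisation `𝔰` of a triangulated category: `𝔰(δ)` is the class of the complexes
`X ⟶ Y ⟶ Z` for which `X ⟶ Y ⟶ Z ⟶ X⟦1⟧` is a distinguished triangle. -/
def realisation {X Z : C} (δ : Z ⟶ X⟦(1 : ℤ)⟧) : Quotient (threeTermSetoid X Z) :=
  Quotient.mk _ (exists_threeTerm δ).choose

theorem realisation_eq_mk_iff {X Z : C} (δ : Z ⟶ X⟦(1 : ℤ)⟧) (a : ThreeTerm X Z) :
    realisation δ = Quotient.mk _ a ↔ Triangle.mk a.f a.g δ ∈ distTriang C := by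
  have h₀ := (exists_threeTerm δ).choose_spec
  refine Iff.trans Quotient.eq ?_
  generalize (exists_threeTerm δ).choose = c at h₀
  refine ⟨?_, fun h => ?_⟩
  · rintro ⟨e, h₁, h₂⟩
    refine isomorphic_distinguished _ h₀ _
      (Triangle.isoMk _ _ (Iso.refl X) e.symm (Iso.refl Z) ?_ ?_ ?_)
    · change a.f ≫ e.inv = 𝟙 X ≫ c.f
      rw [Category.id_comp, ← h₁, Category.assoc, e.hom_inv_id, Category.comp_id]
    · change a.g ≫ 𝟙 Z = e.inv ≫ c.g
      rw [Category.comp_id, ← h₂, e.inv_hom_id_assoc]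
    · change δ ≫ (𝟙 X)⟦(1 : ℤ)⟧' = 𝟙 Z ≫ δ
      rw [CategoryTheory.Functor.map_id, Category.comp_id, Category.id_comp]
  · have h₃ : δ ≫ (𝟙 X)⟦(1 : ℤ)⟧' = 𝟙 Z ≫ δ := by
      rw [CategoryTheory.Functor.map_id, Category.comp_id, Category.id_comp]
    obtain ⟨b, hb₁, hb₂⟩ := complete_distinguished_triangle_morphism₂ _ _ h₀ h (𝟙 X) (𝟙 Z) h₃
    let φ : Triangle.mk c.f c.g δ ⟶ Triangle.mk a.f a.g δ := ⟨𝟙 X, b, 𝟙 Z, hb₁, hb₂, h₃⟩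
    have : IsIso φ.hom₂ := isIso₂_of_isIso₁₃ φ h₀ h
      (inferInstanceAs (IsIso (𝟙 X))) (inferInstanceAs (IsIso (𝟙 Z)))
    refine ⟨@asIso _ _ _ _ b this, ?_, ?_⟩
    · exact hb₁.trans (Category.id_comp _)
    · exact hb₂.symm.trans (Category.comp_id _)

/-- The conflations of `(C, 𝔼_T, 𝔰_T)`, where `𝔰_T` is the restriction of `𝔰` to `𝔼_T`. -/
def IsConflation (T : ObjectProperty C) {X Z : C} (a : ThreeTerm X Z) : Prop :=
  ∃ δ ∈ relExt T Z X, realisation δ = Quotient.mk _ a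

/-- The subgroup of the split Grothendieck group of `C` generated by `[X] - [Y] + [Z]` for all
conflations `X ⟶ Y ⟶ Z` of `(C, 𝔼_T, 𝔰_T)`. -/
def relRelations (T : ObjectProperty C) : AddSubgroup (SplitK₀ C) :=
  AddSubgroup.closure
    {r | ∃ (X Z : C) (a : ThreeTerm X Z), IsConflation T a ∧
      r = SplitK₀.of X - SplitK₀.of a.mid + SplitK₀.of Z}

/-- The Grothendieck group of the extriangulated category `(C, 𝔼_T, 𝔰_T)`. -/
def RelK₀ (T : ObjectProperty C) : Type u := SplitK₀ C ⧸ relRelations T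

instance (T : ObjectProperty C) : AddCommGroup (RelK₀ T) :=
  inferInstanceAs (AddCommGroup (SplitK₀ C ⧸ relRelations T))

/-- The canonical surjection, i.e. the index `[-]_T` as a homomorphism. -/
def relIndex (T : ObjectProperty C) : SplitK₀ C →+ RelK₀ T :=
  QuotientAddGroup.mk' (relRelations T)

/-- The class `[X]_T` of an object of `C`. -/
def RelK₀.of (T : ObjectProperty C) (X : C) : RelK₀ T := relIndex T (SplitK₀.of X)

/-! ### Towers of approximation triangles -/

/-- A tower of `m` distinguished triangles
`V (i + 1) ⟶ T i ⟶ V i ⟶ (V (i + 1))⟦1⟧` for `0 ≤ i < m`, where `V 0 = X`, `V m = T m`, all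
`T i` belong to `T` and each `τ i : T i ⟶ V i` is a minimal right `T`-approximation.
(The remaining arrows `T (i + 1) ⟶ T i` of the tower are the composites `τ (i + 1) ≫ ι i`
for `i + 1 < m`, and `ι (m - 1)` for `i + 1 = m`.) -/
structure ApproxTower (T : ObjectProperty C) (m : ℕ) (X : C) where
  V : Fin (m + 1) → C
  obj : Fin (m + 1) → T.FullSubcategory
  V_zero : V 0 = X
  V_last : V (Fin.last m) = (obj (Fin.last m)).obj
  ι : ∀ i : Fin m, V i.succ ⟶ (obj i.castSucc).obj
  τ : ∀ i : Fin m, (obj i.castSucc).obj ⟶ V i.castSucc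
  ν : ∀ i : Fin m, V i.castSucc ⟶ (V i.succ)⟦(1 : ℤ)⟧
  distinguished : ∀ i : Fin m, Triangle.mk (ι i) (τ i) (ν i) ∈ distTriang C
  minimal : ∀ i : Fin m, IsMinimalRightApprox T (τ i)

/-- The alternating sum `∑ (-1)^i [T i]` in the split Grothendieck group of `T`. -/
def ApproxTower.index {T : ObjectProperty C} {m : ℕ} {X : C} (D : ApproxTower T m X) :
    SplitK₀ T.FullSubcategory :=
  ∑ i : Fin (m + 1), (-1 : ℤ) ^ (i : ℕ) • SplitK₀.of (D.obj i)

end Triangulated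

end ClusterIndex

end

/-! Right `T`-approximations turn towers into resolutions in the relative structure. If `τ : Y ⟶ X`
is one, with fibre `V`, every map from `T` to `X` lifts through `τ`, so `V ⟶ Y ⟶ X` is a conflation
and `[X] = [Y] - [V]` in `RelK₀ T`. Each fibre gains one degree of vanishing of `Hom(T, -⟦j⟧)`;
after `n - 1` steps cluster tilting puts the fibre in `T`. Hence `[X]` is the alternating sum of the
classes of the terms.

The main point is that this sum, taken in the split group of `T`, is additive on conflations
(`HasIndex.add`). The octahedral axiom rotates a conflation `A ⟶ B ⟶ Z` along `V ⟶ Y ⟶ Z` with `Y`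
in `T` into `V ⟶ A ⊞ Y ⟶ B` (`HasConflation.rotate`); repeated rotation reduces additivity to
shorter resolutions and finally to a split conflation. Additivity on `0 ⟶ X ⟶ X` gives independence
of the tower, and in general a map out of `RelK₀ T`, inverse to `[Y] ↦ [Y]_T`. -/

noncomputable section

namespace ClusterIndex

/-! ### Universal property of the split Grothendieck group -/

section SplitLift

variable {A : Type u} [Category.{v} A] [Preadditive A]

theorem SplitK₀.of_eq_of_iso {X Y : A} (e : X ≅ Y) : SplitK₀.of X = SplitK₀.of Y := by
  unfold SplitK₀.of
  rw [show (Quotient.mk (isIsomorphicSetoid A) X) = Quotient.mk _ Y from Quotient.sound ⟨e⟩]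

theorem SplitK₀.of_bicone {X Y : A} (b : BinaryBicone X Y) (hb : b.IsBilimit) :
    SplitK₀.of b.pt = SplitK₀.of X + SplitK₀.of Y := by
  have h : FreeAbelianGroup.of (Quotient.mk (isIsomorphicSetoid A) b.pt) -
      FreeAbelianGroup.of (Quotient.mk _ X) - FreeAbelianGroup.of (Quotient.mk _ Y) ∈
      splitRelations A := AddSubgroup.subset_closure ⟨X, Y, b, ⟨hb⟩, rfl⟩
  have h' := (QuotientAddGroup.eq_zero_iff _).2 h
  rw [← sub_eq_zero, ← sub_sub]
  exact h'

/-- A function on objects that is additive on biproducts extends to the split Grothendieck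
group. -/
def SplitK₀.lift {G : Type*} [AddCommGroup G] (F : A → G)
    (hiso : ∀ X Y : A, (X ≅ Y) → F X = F Y)
    (hadd : ∀ (X Y : A) (b : BinaryBicone X Y), b.IsBilimit → F b.pt = F X + F Y) :
    SplitK₀ A →+ G :=
  QuotientAddGroup.lift (splitRelations A)
    (FreeAbelianGroup.lift (Quotient.lift (s := isIsomorphicSetoid A) F
      (fun X Y h => hiso X Y (Classical.choice h)))) (by
      refine (AddSubgroup.closure_le _).2 ?_
      rintro _ ⟨X, Y, b, ⟨hb⟩, rfl⟩
      simp [AddMonoidHom.mem_ker, hadd X Y b hb])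

@[simp]
theorem SplitK₀.lift_of {G : Type*} [AddCommGroup G] (F : A → G)
    (hiso : ∀ X Y : A, (X ≅ Y) → F X = F Y)
    (hadd : ∀ (X Y : A) (b : BinaryBicone X Y), b.IsBilimit → F b.pt = F X + F Y) (X : A) :
    SplitK₀.lift F hiso hadd (SplitK₀.of X) = F X := by
  change FreeAbelianGroup.lift (Quotient.lift (s := isIsomorphicSetoid A) F
    (fun X Y h => hiso X Y (Classical.choice h)))
    (FreeAbelianGroup.of (Quotient.mk _ X)) = F X
  simp

theorem SplitK₀.hom_ext {G : Type*} [AddCommGroup G] {f g : SplitK₀ A →+ G}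
    (h : ∀ X : A, f (SplitK₀.of X) = g (SplitK₀.of X)) : f = g := by
  refine QuotientAddGroup.addMonoidHom_ext _ (FreeAbelianGroup.lift_ext _ _ ?_)
  rintro ⟨X⟩
  exact h X

end SplitLift

/-! ### Existence of minimal right approximations -/

section MinimalApproximation

/-- An element of a finite-dimensional algebra is stably fixed by an idempotent commuting with it
that is `1` only if the element is invertible. -/
theorem exists_fitting_idempotent {k R : Type*} [Field k] [Ring R] [Algebra k R]
    [Module.Finite k R] (x : R) :
    ∃ (e : R) (m : ℕ), e * e = e ∧ x ^ m * e = x ^ m ∧ (e = 1 → IsUnit x) := by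
  have hp : minpoly k x ≠ 0 := minpoly.ne_zero (Algebra.IsIntegral.isIntegral x)
  obtain ⟨q, hq, hXq⟩ := Polynomial.exists_eq_pow_rootMultiplicity_mul_and_not_dvd _ hp 0
  generalize (minpoly k x).rootMultiplicity 0 = m at hq
  simp only [map_zero, sub_zero] at hq hXq
  have hcop : IsCoprime ((Polynomial.X : Polynomial k) ^ (m + 1)) q :=
    (((Polynomial.irreducible_X).coprime_iff_not_dvd).2 hXq).pow_left
  obtain ⟨a, b, hab⟩ := hcop
  have hz : ∀ r : Polynomial k, Polynomial.aeval x (Polynomial.X ^ m * q * r) = 0 := by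
    intro r
    rw [map_mul, ← hq, minpoly.aeval, zero_mul]
  -- Here `minpoly = X ^ m * q` and `a * X ^ (m + 1) + b * q = 1`. The exponent `m + 1` leaves a
  -- factor `X` in the idempotent even when `m = 0`, so that `e = 1` exhibits an inverse of `x`.
  refine ⟨Polynomial.aeval x (a * Polynomial.X ^ (m + 1)), m + 1, ?_, ?_, ?_⟩
  · rw [← map_mul, ← sub_eq_zero, ← map_sub, ← hz (-(Polynomial.X * a * b))]
    congr 1
    linear_combination (a * Polynomial.X ^ (m + 1)) * hab
  · rw [← Polynomial.aeval_X_pow (R := k) x, ← map_mul, ← sub_eq_zero, ← map_sub,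
      ← hz (-(Polynomial.X * b))]
    congr 1
    linear_combination (Polynomial.X ^ (m + 1)) * hab
  · intro h
    have h1 : Polynomial.aeval x (a * Polynomial.X ^ m) * x = 1 := by
      rw [← h, pow_succ, ← mul_assoc, map_mul _ (a * Polynomial.X ^ m), Polynomial.aeval_X]
    have h2 : x * Polynomial.aeval x (a * Polynomial.X ^ m) = 1 := by
      rw [← h, show a * Polynomial.X ^ (m + 1) = Polynomial.X * (a * Polynomial.X ^ m) by ring,
        map_mul _ Polynomial.X, Polynomial.aeval_X]
    exact ⟨⟨x, _, h2, h1⟩, rfl⟩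

theorem IsRightApprox.of_retract {C : Type u} [Category.{v} C] {T : ObjectProperty C}
    [T.IsStableUnderRetracts] {X Y Y' : C} {τ : Y ⟶ X} (hτ : IsRightApprox T τ) {i : Y' ⟶ Y} {r : Y ⟶ Y'}
    (hir : i ≫ r = 𝟙 Y') (he : (r ≫ i) ≫ τ = τ) : IsRightApprox T (i ≫ τ) where
  mem := T.prop_of_retract ⟨i, r, hir⟩ hτ.mem
  factors Z hZ f := by
    obtain ⟨g, rfl⟩ := hτ.factors Z hZ f
    exact ⟨g ≫ r, by rw [Category.assoc, ← Category.assoc r, he]⟩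

variable {C : Type u} [Category.{v} C] [Preadditive C] [IsIdempotentComplete C]

/-- An approximation whose source has an endomorphism algebra of least dimension is minimal: if `φ ≫
τ = τ`, the Fitting idempotent of `φ` also fixes `τ`, and splitting it would give a smaller
approximation unless it is `1`. -/
theorem exists_isMinimalRightApprox (k : Type w) [Field k] [Linear k C]
    (homFinite : ∀ X Y : C, Module.Finite k (X ⟶ Y))
    {T : ObjectProperty C} [T.IsStableUnderRetracts] {X : C}
    (h : ∃ (Y : C) (τ : Y ⟶ X), IsRightApprox T τ) :
    ∃ (Y : C) (τ : Y ⟶ X), IsMinimalRightApprox T τ := by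
  classical
  have hne : ∃ d : ℕ, ∃ (Y : C) (τ : Y ⟶ X), IsRightApprox T τ ∧
      Module.finrank k (Y ⟶ Y) = d := by
    obtain ⟨Y, τ, hτ⟩ := h
    exact ⟨_, Y, τ, hτ, rfl⟩
  obtain ⟨Y, τ, hτ, hd⟩ := Nat.find_spec hne
  refine ⟨Y, τ, ⟨hτ, fun φ hφ => ?_⟩⟩
  have : Module.Finite k (End Y) := homFinite Y Y
  obtain ⟨e, m, hee, hem, hunit⟩ := exists_fitting_idempotent (k := k) (R := End Y) φ
  have hpow : ∀ (ψ : End Y) (m : ℕ), ψ ≫ τ = τ → (ψ ^ m) ≫ τ = τ := by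
    intro ψ m hψ
    induction m with
    | zero => exact Category.id_comp τ
    | succ m ih => rw [pow_succ, End.mul_def, Category.assoc, ih, hψ]
  have heτ : e ≫ τ = τ := by
    conv_lhs => rw [← hpow φ m hφ, ← Category.assoc, ← End.mul_def, hem, hpow φ m hφ]
  obtain ⟨Y', i, r, hir, hri⟩ := IsIdempotentComplete.idempotents_split Y e hee
  have hle := Nat.find_min' hne ⟨Y', i ≫ τ, hτ.of_retract hir (by rw [hri, heτ]), rfl⟩
  rw [← hd] at hle
  -- `L` embeds `End Y'` as the corner of `End Y` cut out by `e`. By the choice of `Y` the corner is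
  -- everything, so it contains the identity and `e = 1`.
  let L : (Y' ⟶ Y') →ₗ[k] (Y ⟶ Y) :=
    (Linear.leftComp k Y r).comp (Linear.rightComp k Y' i)
  have hL : ∀ a, L a = r ≫ a ≫ i := fun a => rfl
  have hLinj : Function.Injective L := by
    intro a b hab
    have : i ≫ (r ≫ a ≫ i) ≫ r = i ≫ (r ≫ b ≫ i) ≫ r := by rw [← hL, ← hL, hab]
    simpa [reassoc_of% hir, hir] using this
  have := homFinite Y Y
  have := homFinite Y' Y'
  have hLsurj : Function.Surjective L :=
    (LinearMap.injective_iff_surjective_of_finrank_eq_finrank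
      (le_antisymm (LinearMap.finrank_le_finrank_of_injective hLinj) hle)).1 hLinj
  obtain ⟨a, ha⟩ := hLsurj (𝟙 Y)
  have he1 : e = 1 := by
    have : e ≫ L a = L a := by
      rw [hL, ← hri]
      simp [reassoc_of% hir]
    rw [ha, Category.comp_id] at this
    exact this
  exact (isUnit_iff_isIso (X := Y) φ).1 (hunit he1)

end MinimalApproximation

/-! ### Relative conflations and their rotation -/

section Conflations

open ZeroObject

variable {C : Type u} [Category.{v} C] [Preadditive C] [HasZeroObject C] [HasShift C ℤ]
  [∀ i : ℤ, (shiftFunctor C i).Additive] [Pretriangulated C] {T : ObjectProperty C}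

/-- `X ⟶ Y ⟶ Z` extends to a distinguished triangle whose third morphism lies in `relExt T`. -/
def HasConflation (T : ObjectProperty C) (X Y Z : C) : Prop :=
  ∃ (f : X ⟶ Y) (g : Y ⟶ Z) (δ : Z ⟶ X⟦(1 : ℤ)⟧),
    Triangle.mk f g δ ∈ distTriang C ∧ δ ∈ relExt T Z X

theorem IsConflation.hasConflation {X Z : C} {a : ThreeTerm X Z} (h : IsConflation T a) :
    HasConflation T X a.mid Z := by
  obtain ⟨δ, hδ, hr⟩ := h
  exact ⟨a.f, a.g, δ, (realisation_eq_mk_iff δ a).1 hr, hδ⟩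

theorem HasConflation.relIndex_eq {X Y Z : C} (h : HasConflation T X Y Z) :
    RelK₀.of T Y = RelK₀.of T X + RelK₀.of T Z := by
  obtain ⟨f, g, δ, hd, hδ⟩ := h
  let a : ThreeTerm X Z := ⟨Y, f, g, comp_distTriang_mor_zero₁₂ _ hd⟩
  have hmem : SplitK₀.of X - SplitK₀.of Y + SplitK₀.of Z ∈ relRelations T :=
    AddSubgroup.subset_closure ⟨X, Z, a, ⟨δ, hδ, (realisation_eq_mk_iff δ a).2 hd⟩, rfl⟩
  have h0 : relIndex T (SplitK₀.of X - SplitK₀.of Y + SplitK₀.of Z) = 0 :=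
    (QuotientAddGroup.eq_zero_iff _).2 hmem
  rw [map_add, map_sub, sub_add_eq_add_sub, sub_eq_zero] at h0
  exact h0.symm

theorem HasConflation.of_iso {X Y Z X' Y' Z' : C} (h : HasConflation T X Y Z)
    (eX : X ≅ X') (eY : Y ≅ Y') (eZ : Z ≅ Z') : HasConflation T X' Y' Z' := by
  obtain ⟨f, g, δ, hd, hδ⟩ := h
  refine ⟨eX.inv ≫ f ≫ eY.hom, eY.inv ≫ g ≫ eZ.hom, eZ.inv ≫ δ ≫ eX.hom⟦(1 : ℤ)⟧',
    isomorphic_distinguished _ hd _ (Triangle.isoMk _ _ eX.symm eY.symm eZ.symm ?_ ?_ ?_),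
    relExt_map_mem T eZ.inv eX.hom hδ⟩
  · exact (by simp : (eX.inv ≫ f ≫ eY.hom) ≫ eY.inv = eX.inv ≫ f)
  · exact (by simp : (eY.inv ≫ g ≫ eZ.hom) ≫ eZ.inv = eY.inv ≫ g)
  · exact (by simp [← Functor.map_comp] :
      (eZ.inv ≫ δ ≫ eX.hom⟦(1 : ℤ)⟧') ≫ eX.inv⟦(1 : ℤ)⟧' = eZ.inv ≫ δ)

theorem hasConflation_biprod (T : ObjectProperty C) (X Z : C) : HasConflation T X (X ⊞ Z) Z :=
  ⟨_, _, _, binaryBiproductTriangle_distinguished X Z, (relExt T Z X).zero_mem⟩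

theorem hasConflation_zero_left (T : ObjectProperty C) (X : C) :
    HasConflation T 0 X X :=
  (hasConflation_biprod T 0 X).of_iso (Iso.refl _) (isoZeroBiprod (isZero_zero C)).symm
    (Iso.refl _)

theorem IsRightApprox.hasConflation {V Y X : C} {f : V ⟶ Y} {τ : Y ⟶ X} {δ : X ⟶ V⟦(1 : ℤ)⟧}
    (hd : Triangle.mk f τ δ ∈ distTriang C) (hτ : IsRightApprox T τ) :
    HasConflation T V Y X := by
  refine ⟨f, τ, δ, hd, fun Z hZ ξ => ?_⟩
  obtain ⟨g, rfl⟩ := hτ.factors Z hZ ξ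
  have : τ ≫ δ = 0 := comp_distTriang_mor_zero₂₃ _ hd
  rw [Category.assoc, this, comp_zero]

/-- The connecting morphism, tested on the identity of `Z`, is zero, so the triangle splits. -/
theorem HasConflation.nonempty_iso_biprod {X Y Z : C} (h : HasConflation T X Y Z) (hZ : T Z) :
    Nonempty (Y ≅ X ⊞ Z) := by
  obtain ⟨f, g, δ, hd, hδ⟩ := h
  have h0 : δ = 0 := by simpa using hδ Z hZ (𝟙 Z)
  obtain ⟨e, -⟩ := exists_iso_binaryBiproduct_of_distTriang _ hd h0
  exact ⟨e⟩

theorem hasConflation_of_isBilimit (T : ObjectProperty C) {X Z : C} (b : BinaryBicone X Z)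
    (hb : b.IsBilimit) : HasConflation T X b.pt Z :=
  (hasConflation_biprod T X Z).of_iso (Iso.refl _) (biprod.uniqueUpToIso X Z hb).symm
    (Iso.refl _)

/-- The rotation of a conflation `A ⟶ B ⟶ Z` along a conflation `V ⟶ Y ⟶ Z` with `Y` in `T`. -/
theorem HasConflation.rotate [IsTriangulated C] {A B Z V Y : C} (h : HasConflation T A B Z)
    (hY : T Y) (h' : HasConflation T V Y Z) : HasConflation T V (A ⊞ Y) B := by
  obtain ⟨f, g, δ, hd, hδ⟩ := h
  obtain ⟨i, τ, ε, hd', hε⟩ := h'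
  -- The map `τ` starts in `T`, so it is killed by `δ` and lifts through `g`.
  obtain ⟨l, hl⟩ : ∃ l : Y ⟶ B, τ = l ≫ g :=
    Triangle.coyoneda_exact₃ _ hd τ (hδ Y hY τ)
  obtain ⟨W, a, b, hW⟩ := distinguished_cocone_triangle₁ (biprod.desc f l)
  have hsplit : Triangle.mk biprod.inl biprod.snd (0 : Y ⟶ A⟦(1 : ℤ)⟧) ∈ distTriang C :=
    binaryBiproductTriangle_distinguished A Y
  have hW' : Triangle.mk (biprod.desc f l) b (-a⟦(1 : ℤ)⟧') ∈ distTriang C :=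
    rot_of_distTriang _ hW
  have hd'' : Triangle.mk τ ε (-i⟦(1 : ℤ)⟧') ∈ distTriang C := rot_of_distTriang _ hd'
  -- The octahedron on `A ⟶ A ⊞ Y ⟶ B`, with composite `f`, has cones `Y`, `W⟦1⟧` and `Z`. Its
  -- triangle `Y ⟶ Z ⟶ W⟦1⟧` begins with `τ`, which identifies `W` with the fibre `V`.
  obtain ⟨O⟩ := IsTriangulated.octahedron_axiom (biprod.inl_desc f l) hsplit hW' hd
  have hm₁ : O.m₁ = τ := by
    have h₁ := O.comm₁
    have h₂ : (biprod.inr : Y ⟶ A ⊞ Y) ≫ biprod.snd ≫ O.m₁ = biprod.inr ≫ biprod.desc f l ≫ g := by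
      rw [h₁]
    simpa [← hl] using h₂
  have hm₃ : g ≫ O.m₃ = b := O.comm₃
  obtain ⟨e, -⟩ := exists_iso_of_arrow_iso _ _ hd'' O.mem
    (Arrow.isoMk (Iso.refl _) (Iso.refl _)
      (by exact (by simp [hm₁] : 𝟙 Y ≫ O.m₁ = τ ≫ 𝟙 Z)))
  have eVW : V ≅ W := (shiftFunctor C (1 : ℤ)).preimageIso (Triangle.π₃.mapIso e)
  -- As `b = g ≫ O.m₃`, a map from `T` to `B` only matters through its image in `Z`; this lifts
  -- through `τ`, which `O.m₃` kills.
  have hb : b ∈ relExt T B W := by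
    intro S hS ξ
    obtain ⟨ξ', hξ'⟩ : ∃ ξ' : S ⟶ Y, ξ ≫ g = ξ' ≫ τ :=
      Triangle.coyoneda_exact₃ _ hd' (ξ ≫ g) (hε S hS _)
    have h0 : O.m₁ ≫ O.m₃ = 0 := comp_distTriang_mor_zero₁₂ _ O.mem
    rw [← hm₃, ← Category.assoc, hξ', Category.assoc, ← hm₁, h0, comp_zero]
  exact HasConflation.of_iso ⟨a, _, b, hW, hb⟩ eVW.symm (Iso.refl _) (Iso.refl _)

end Conflations

/-! ### Classes of objects of an additive subcategory -/

section AdditiveSubcategory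

open ZeroObject

variable {C : Type u} [Category.{v} C] [Preadditive C] {T : ObjectProperty C}

theorem SplitK₀.of_fullSubcategory_iso {X Y : C} (hX : T X) (hY : T Y) (e : X ≅ Y) :
    SplitK₀.of (⟨X, hX⟩ : T.FullSubcategory) = SplitK₀.of (⟨Y, hY⟩ : T.FullSubcategory) :=
  SplitK₀.of_eq_of_iso (ObjectProperty.isoMk _ e)

theorem IsAdditiveSubcategory.zero_mem {C : Type u} [Category.{v} C] [HasZeroObject C]
    {T : ObjectProperty C} (hT : IsAdditiveSubcategory T) :
    T (0 : C) := by
  have := hT.closedUnderSums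
  exact T.prop_of_isTerminal _ (isZero_zero C).isTerminal

variable [HasBinaryBiproducts C]

theorem IsAdditiveSubcategory.biprod_mem (hT : IsAdditiveSubcategory T) {X Y : C} (hX : T X)
    (hY : T Y) : T (X ⊞ Y) := by
  have := hT.closedUnderSums
  exact T.prop_of_isLimit_binaryFan (BinaryBiproduct.isLimit X Y) hX hY

theorem SplitK₀.of_biprod {X Y : C} (hX : T X) (hY : T Y) (hXY : T (X ⊞ Y)) :
    SplitK₀.of (⟨X ⊞ Y, hXY⟩ : T.FullSubcategory) =
      SplitK₀.of (⟨X, hX⟩ : T.FullSubcategory) + SplitK₀.of (⟨Y, hY⟩ : T.FullSubcategory) :=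
  SplitK₀.of_bicone (A := T.FullSubcategory) (X := ⟨X, hX⟩) (Y := ⟨Y, hY⟩)
    { pt := ⟨X ⊞ Y, hXY⟩
      fst := ObjectProperty.homMk biprod.fst
      snd := ObjectProperty.homMk biprod.snd
      inl := ObjectProperty.homMk biprod.inl
      inr := ObjectProperty.homMk biprod.inr
      inl_fst := by ext; simp
      inl_snd := by ext; simp
      inr_fst := by ext; simp
      inr_snd := by ext; simp }
    (isBinaryBilimitOfTotal _ (ObjectProperty.hom_ext _ biprod.total))

theorem SplitK₀.of_zero [HasZeroObject C] (hT : IsAdditiveSubcategory T) :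
    SplitK₀.of (⟨0, hT.zero_mem⟩ : T.FullSubcategory) = 0 := by
  have h := SplitK₀.of_biprod hT.zero_mem hT.zero_mem (hT.biprod_mem hT.zero_mem hT.zero_mem)
  rw [SplitK₀.of_fullSubcategory_iso _ hT.zero_mem (isoZeroBiprod (isZero_zero C)).symm] at h
  simpa using h

end AdditiveSubcategory

/-! ### The index through resolutions, and its additivity -/

section Index

open ZeroObject

variable {C : Type u} [Category.{v} C] [Preadditive C] [HasZeroObject C] [HasShift C ℤ]
  [∀ i : ℤ, (shiftFunctor C i).Additive] [Pretriangulated C] {T : ObjectProperty C}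

variable (T) in
/-- `a` is the alternating sum of the terms of a resolution of `X` of length `m` by objects of
`T`, in which the successive syzygies form conflations. -/
inductive HasIndex : ℕ → C → SplitK₀ T.FullSubcategory → Prop
  | zero (Y : C) (hY : T Y) : HasIndex 0 Y (SplitK₀.of ⟨Y, hY⟩)
  | succ {m : ℕ} {V Y X : C} {a : SplitK₀ T.FullSubcategory} (hY : T Y)
      (h : HasConflation T V Y X) (hV : HasIndex m V a) :
      HasIndex (m + 1) X (SplitK₀.of ⟨Y, hY⟩ - a)

theorem HasIndex.of_iso (hT : IsAdditiveSubcategory T) {m : ℕ} {X X' : C}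
    {a : SplitK₀ T.FullSubcategory} (h : HasIndex T m X a) (e : X ≅ X') : HasIndex T m X' a := by
  cases h with
  | zero _ hX =>
    have := hT.closedUnderIso
    rw [SplitK₀.of_fullSubcategory_iso hX (T.prop_of_iso e hX) e]
    exact .zero _ _
  | succ hY h hV => exact .succ hY (h.of_iso (Iso.refl _) (Iso.refl _) e) hV

theorem hasIndex_zero (hT : IsAdditiveSubcategory T) (m : ℕ) : HasIndex T m (0 : C) 0 := by
  induction m with
  | zero =>
    rw [← SplitK₀.of_zero hT]
    exact .zero _ _
  | succ m ih =>
    rw [← sub_zero (0 : SplitK₀ T.FullSubcategory)]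
    nth_rw 1 [← SplitK₀.of_zero hT]
    exact .succ _ (hasConflation_zero_left T 0) ih

/-- Padding with zero objects brings the trivial resolution to length `m`, since indices are only
compared at equal length. -/
theorem hasIndex_of_mem (hT : IsAdditiveSubcategory T) (m : ℕ) {Y : C} (hY : T Y) :
    HasIndex T m Y (SplitK₀.of ⟨Y, hY⟩) := by
  cases m with
  | zero => exact .zero _ _
  | succ m =>
    rw [← sub_zero (SplitK₀.of _)]
    exact .succ _ (hasConflation_zero_left T Y) (hasIndex_zero hT m)

variable [IsTriangulated C]

/-- Rotating the split conflation `Y ⟶ Y ⊞ X ⟶ X` enlarges the first term of the resolution by `Y`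
and leaves the syzygy unchanged. -/
theorem HasIndex.biprod (hT : IsAdditiveSubcategory T) {m : ℕ} {X Y : C}
    {a : SplitK₀ T.FullSubcategory} (h : HasIndex T m X a) (hY : T Y) :
    HasIndex T m (X ⊞ Y) (a + SplitK₀.of ⟨Y, hY⟩) := by
  cases h with
  | zero _ hX =>
    rw [← SplitK₀.of_biprod hX hY (hT.biprod_mem hX hY)]
    exact .zero _ _
  | succ hY' h hV =>
    rw [sub_add_eq_add_sub, add_comm (SplitK₀.of _),
      ← SplitK₀.of_biprod hY hY' (hT.biprod_mem hY hY')]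
    exact HasIndex.of_iso hT (.succ _ ((hasConflation_biprod T Y X).rotate hY' h) hV)
      (biprod.braiding _ _)

/-- The index is additive on conflations. -/
theorem HasIndex.add (hT : IsAdditiveSubcategory T) {m : ℕ} {A B Z : C}
    {a b c : SplitK₀ T.FullSubcategory} (h : HasConflation T A B Z) (ha : HasIndex T m A a)
    (hb : HasIndex T m B b) (hc : HasIndex T m Z c) : b = a + c := by
  induction m generalizing A B Z a b c with
  | zero =>
    obtain ⟨_, hA⟩ := ha
    obtain ⟨_, hB⟩ := hb
    obtain ⟨_, hZ⟩ := hc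
    obtain ⟨e⟩ := h.nonempty_iso_biprod hZ
    rw [← SplitK₀.of_biprod hA hZ (hT.biprod_mem hA hZ)]
    exact SplitK₀.of_fullSubcategory_iso _ _ e
  | succ m ih =>
    obtain ⟨⟩ | ⟨hYa, hca, hVa⟩ := ha
    obtain ⟨⟩ | ⟨hYb, hcb, hVb⟩ := hb
    obtain ⟨⟩ | ⟨hYc, hcc, hVc⟩ := hc
    rename_i YC _
    -- Write `Y_`, `V_` for the first terms and syzygies of `A`, `B`, `Z = C`. Then `h₁` is `V_B ⟶
    -- V_C ⊞ Y_B ⟶ A ⊞ Y_C`, and `h₂` is `V_A ⟶ Y_C ⊞ Y_A ⟶ A ⊞ Y_C`.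
    have h₁ := (h.rotate hYc hcc).rotate hYb hcb
    have h₂ := ((hasConflation_biprod T _ A).rotate hYa hca).of_iso (Iso.refl _) (Iso.refl _)
      (biprod.braiding YC A)
    -- A third rotation gives `V_A ⟶ V_B ⊞ (Y_C ⊞ Y_A) ⟶ V_C ⊞ Y_B`. Its terms are syzygies up to
    -- summands in `T`, so they have resolutions of length `m`.
    have h₃ := ih (h₁.rotate (hT.biprod_mem hYc hYa) h₂) hVa
      (hVb.biprod hT (hT.biprod_mem hYc hYa)) (hVc.biprod hT hYb)
    rw [SplitK₀.of_biprod hYc hYa] at h₃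
    rw [sub_add_sub_comm, sub_eq_sub_iff_add_eq_add]
    refine Eq.trans ?_ (h₃.symm.trans ?_) <;> abel

/-- This is additivity on `0 ⟶ X ⟶ X`; minimality of the approximations plays no role. -/
theorem HasIndex.unique (hT : IsAdditiveSubcategory T) {m : ℕ} {X : C}
    {a b : SplitK₀ T.FullSubcategory} (ha : HasIndex T m X a) (hb : HasIndex T m X b) : a = b := by
  simpa using HasIndex.add hT (hasConflation_zero_left T X) (hasIndex_zero hT m) ha hb

end Index

/-! ### Existence of towers by counting vanishing degrees -/

section Tower

variable {C : Type u} [Category.{v} C] [Preadditive C] [HasZeroObject C] [HasShift C ℤ]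
  [∀ i : ℤ, (shiftFunctor C i).Additive] [Pretriangulated C] {T : ObjectProperty C}

/-- The tower of an object of `T`. -/
def ApproxTower.ofMem {X : C} (hX : T X) : ApproxTower T 0 X where
  V _ := X
  obj _ := ⟨X, hX⟩
  V_zero := rfl
  V_last := rfl
  ι i := i.elim0
  τ i := i.elim0
  ν i := i.elim0
  distinguished i := i.elim0
  minimal i := i.elim0

/-- Extending a tower by one approximation triangle. -/
def ApproxTower.cons {m : ℕ} {V Y X : C} (D : ApproxTower T m V) {f : V ⟶ Y} {τ : Y ⟶ X}
    {δ : X ⟶ V⟦(1 : ℤ)⟧} (hd : Triangle.mk f τ δ ∈ distTriang C)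
    (hτ : IsMinimalRightApprox T τ) : ApproxTower T (m + 1) X where
  V := Fin.cases (motive := fun _ => C) X D.V
  obj := Fin.cases (motive := fun _ => T.FullSubcategory) ⟨Y, hτ.mem⟩ D.obj
  V_zero := rfl
  V_last := D.V_last
  ι := Fin.cases (eqToHom D.V_zero ≫ f) D.ι
  τ := Fin.cases τ D.τ
  ν := Fin.cases (δ ≫ (eqToHom D.V_zero.symm)⟦(1 : ℤ)⟧') D.ν
  distinguished := Fin.cases (by
    obtain ⟨V, obj, rfl, -, -, -, -, -, -⟩ := D
    change Triangle.mk (𝟙 _ ≫ f) τ (δ ≫ (𝟙 _)⟦(1 : ℤ)⟧') ∈ distTriang C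
    simpa using hd) D.distinguished
  minimal := Fin.cases hτ D.minimal

theorem ApproxTower.hasIndex {m : ℕ} {X : C} (D : ApproxTower T m X) :
    HasIndex T m X D.index := by
  induction m generalizing X with
  | zero =>
    obtain ⟨V, obj, hV, hl, ι, τ, ν, hd, hm⟩ := D
    obtain rfl : (obj 0).obj = X := hl.symm.trans hV
    convert HasIndex.zero (obj 0).obj (obj 0).property using 1
    simp [ApproxTower.index]
  | succ m ih =>
    obtain ⟨V, obj, rfl, hl, ι, τ, ν, hd, hm⟩ := D
    have h := ih (X := V 1) ⟨fun i => V i.succ, fun i => obj i.succ, rfl, hl,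
      fun i => ι i.succ, fun i => τ i.succ, fun i => ν i.succ, fun i => hd i.succ,
      fun i => hm i.succ⟩
    have h' : HasIndex T (m + 1) (V 0) _ :=
      .succ (hm 0).mem ((hm 0).toIsRightApprox.hasConflation (hd 0)) h
    convert h' using 1
    change ∑ i : Fin (m + 2), (-1 : ℤ) ^ (i : ℕ) • SplitK₀.of (obj i) =
      SplitK₀.of (obj 0) - ∑ i : Fin (m + 1), (-1 : ℤ) ^ (i : ℕ) • SplitK₀.of (obj i.succ)
    rw [Fin.sum_univ_succ]
    simp [pow_succ, sub_eq_add_neg]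

/-- Vanishing of `Hom(T, X⟦j⟧)` in the degrees `1 ≤ j < d`. -/
def ExtVanishing (T : ObjectProperty C) (d : ℕ) (X : C) : Prop :=
  ∀ j : ℕ, 1 ≤ j → j < d → ∀ Y : C, T Y → ∀ f : Y ⟶ X⟦(j : ℤ)⟧, f = 0

/-- The fibre of a right approximation has one more vanishing degree. -/
theorem ExtVanishing.fibre {d N : ℕ} {V Y X : C} {f : V ⟶ Y} {τ : Y ⟶ X} {δ : X ⟶ V⟦(1 : ℤ)⟧}
    (hd : Triangle.mk f τ δ ∈ distTriang C) (hτ : IsRightApprox T τ)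
    (hX : ExtVanishing T d X) (hY : ExtVanishing T N Y) (hdN : d + 1 ≤ N) :
    ExtVanishing T (d + 1) V := by
  rintro (_ | _ | j) hj hjd Z hZ ξ
  · omega
  · change Z ⟶ V⟦(1 : ℤ)⟧ at ξ
    obtain ⟨g, hg⟩ : ∃ g : Z ⟶ X, ξ = g ≫ δ :=
      Triangle.coyoneda_exact₁ _ hd ξ (hY 1 le_rfl (by omega) Z hZ _)
    obtain ⟨g', rfl⟩ := hτ.factors Z hZ g
    have h0 : τ ≫ δ = 0 := comp_distTriang_mor_zero₂₃ _ hd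
    rw [hg, Category.assoc, h0, comp_zero]
  -- In higher degrees, `V` is squeezed between `X` one degree lower and `Y` in the same degree; `e`
  -- matches the shift with that of the shifted triangle.
  · let e : ∀ W : C, W⟦((j + 1 + 1 : ℕ) : ℤ)⟧ ≅ W⟦((j + 1 : ℕ) : ℤ)⟧⟦(1 : ℤ)⟧ := fun W =>
      (shiftFunctorAdd' C ((j + 1 : ℕ) : ℤ) 1 ((j + 1 + 1 : ℕ) : ℤ) (by simp)).app W
    have hY' : ∀ η : Z ⟶ Y⟦((j + 1 : ℕ) : ℤ)⟧⟦(1 : ℤ)⟧, η = 0 := fun η => by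
      rw [← cancel_mono (e Y).inv, zero_comp]
      exact hY _ hj (by omega) Z hZ _
    obtain ⟨g, hg⟩ := Triangle.coyoneda_exact₁ _
      (Triangle.shift_distinguished _ hd ((j + 1 : ℕ) : ℤ)) (ξ ≫ (e V).hom) (hY' _)
    rw [show g = 0 from hX (j + 1) (by omega) (by omega) Z hZ g] at hg
    rw [← cancel_mono (e V).hom, zero_comp]
    exact hg.trans zero_comp

/-- The sum `m + d` is constant: each triangle trades one remaining step for one vanishing degree.
At `d = N` the fibre lies in `T`, and at `d = 1` the vanishing condition is empty. -/
theorem nonempty_approxTower {N : ℕ} (hmem : ∀ X, T X ↔ ExtVanishing T N X)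
    (happ : ∀ X : C, ∃ (Y : C) (τ : Y ⟶ X), IsMinimalRightApprox T τ) {m d : ℕ}
    (hm : m + d = N) (X : C) (hX : ExtVanishing T d X) : Nonempty (ApproxTower T m X) := by
  induction m generalizing d X with
  | zero =>
    obtain rfl : d = N := by omega
    exact ⟨.ofMem ((hmem X).2 hX)⟩
  | succ m ih =>
    obtain ⟨Y, τ, hτ⟩ := happ X
    obtain ⟨V, f, δ, hd⟩ := distinguished_cocone_triangle₁ τ
    obtain ⟨D⟩ := ih (d := d + 1) (by omega) V
      (hX.fibre hd hτ.toIsRightApprox ((hmem Y).1 hτ.mem) (by omega))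
    exact ⟨D.cons hd hτ⟩

end Tower

/-! ### The isomorphism with the relative Grothendieck group -/

section Comparison

variable {C : Type u} [Category.{v} C] [Preadditive C] [HasZeroObject C] [HasShift C ℤ]
  [∀ i : ℤ, (shiftFunctor C i).Additive] [Pretriangulated C] {T : ObjectProperty C}

/-- The homomorphism `[Y] ↦ [Y]_T` on the split Grothendieck group of `T`. -/
def splitToRel (T : ObjectProperty C) : SplitK₀ T.FullSubcategory →+ RelK₀ T :=
  SplitK₀.lift (fun Y => RelK₀.of T Y.obj)
    (fun _ _ e => congrArg (relIndex T) (SplitK₀.of_eq_of_iso (T.ι.mapIso e)))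
    (fun _ _ b hb =>
      have := preservesBinaryBiproducts_of_preservesBiproducts T.ι
      (hasConflation_of_isBilimit T (T.ι.mapBinaryBicone b)
        (isBinaryBilimitOfPreserves T.ι hb)).relIndex_eq)

theorem splitToRel_of (Y : T.FullSubcategory) :
    splitToRel T (SplitK₀.of Y) = RelK₀.of T Y.obj :=
  SplitK₀.lift_of (fun Y : T.FullSubcategory => RelK₀.of T Y.obj) _ _ Y

theorem HasIndex.splitToRel_eq {m : ℕ} {X : C} {a : SplitK₀ T.FullSubcategory}
    (h : HasIndex T m X a) : splitToRel T a = RelK₀.of T X := by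
  induction h with
  | zero Y hY => exact splitToRel_of _
  | succ hY h _ ih => rw [map_sub, splitToRel_of, ih, h.relIndex_eq, add_sub_cancel_left]

variable [IsTriangulated C]

/-- If every object has an index, then the index induces an isomorphism from `RelK₀ T` to the split
Grothendieck group of `T`. -/
theorem exists_index_equiv (hT : IsAdditiveSubcategory T) {m : ℕ}
    (hres : ∀ X : C, ∃ a, HasIndex T m X a) :
    ∃ (ind : SplitK₀ C →+ SplitK₀ T.FullSubcategory) (Φ : RelK₀ T ≃+ SplitK₀ T.FullSubcategory),
      (∀ (X : C) (a), HasIndex T m X a → ind (SplitK₀.of X) = a) ∧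
      Φ.toAddMonoidHom.comp (relIndex T) = ind ∧
      (∀ Y : T.FullSubcategory, Φ.symm (SplitK₀.of Y) = RelK₀.of T Y.obj) := by
  choose F hF using hres
  have hFadd : ∀ {X Y Z : C}, HasConflation T X Y Z → F Y = F X + F Z := fun h =>
    HasIndex.add hT h (hF _) (hF _) (hF _)
  let ind : SplitK₀ C →+ SplitK₀ T.FullSubcategory := SplitK₀.lift F
    (fun X Y e => ((hF X).of_iso hT e).unique hT (hF Y))
    (fun X Y b hb => hFadd (hasConflation_of_isBilimit T b hb))
  have hind : ∀ X, ind (SplitK₀.of X) = F X := SplitK₀.lift_of F _ _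
  have hker : relRelations T ≤ ind.ker := by
    refine (AddSubgroup.closure_le _).2 ?_
    rintro _ ⟨X, Z, a, ha, rfl⟩
    change ind _ = 0
    rw [map_add, map_sub, hind, hind, hind, hFadd ha.hasConflation]
    abel
  let φ : RelK₀ T →+ SplitK₀ T.FullSubcategory := QuotientAddGroup.lift (relRelations T) ind hker
  have hφ : ∀ x, φ (relIndex T x) = ind x := fun _ => rfl
  -- One composite is the identity because a resolution computes `[X]_T`, the other because an
  -- object of `T` resolves itself.
  have h₁ : (splitToRel T).comp φ = AddMonoidHom.id _ := by
    refine QuotientAddGroup.addMonoidHom_ext _ (SplitK₀.hom_ext fun X => ?_)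
    change splitToRel T (φ (relIndex T (SplitK₀.of X))) = relIndex T (SplitK₀.of X)
    rw [hφ, hind]
    exact (hF X).splitToRel_eq
  have h₂ : φ.comp (splitToRel T) = AddMonoidHom.id _ := by
    refine SplitK₀.hom_ext fun Y => ?_
    change φ (splitToRel T (SplitK₀.of Y)) = SplitK₀.of Y
    rw [splitToRel_of, RelK₀.of, hφ, hind]
    exact (hF _).unique hT (hasIndex_of_mem hT m Y.property)
  exact ⟨ind, φ.toAddEquiv (splitToRel T) h₁ h₂,
    fun X a ha => (hind X).trans ((hF X).unique hT ha), rfl, splitToRel_of⟩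

end Comparison

end ClusterIndex
end

theorem theoremB
    {k : Type w} [Field k]
    {C : Type u} [Category.{v} C] [Preadditive C] [Linear k C] [HasZeroObject C]
    [HasShift C ℤ] [∀ i : ℤ, (shiftFunctor C i).Additive] [Pretriangulated C] [IsTriangulated C]
    [EssentiallySmall.{w'} C] [IsIdempotentComplete C]
    (homFinite : ∀ X Y : C, Module.Finite k (X ⟶ Y))
    (n : ℕ) (hn : 2 ≤ n)
    (T : ObjectProperty C) (hT : ClusterIndex.IsClusterTilting n T) :
    (∀ X : C, Nonempty (ClusterIndex.ApproxTower T (n - 1) X)) ∧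
    ∃ (ind : ClusterIndex.SplitK₀ C →+ ClusterIndex.SplitK₀ T.FullSubcategory)
      (Φ : ClusterIndex.RelK₀ T ≃+ ClusterIndex.SplitK₀ T.FullSubcategory),
      (∀ (X : C) (D : ClusterIndex.ApproxTower T (n - 1) X),
        ind (ClusterIndex.SplitK₀.of X) = D.index) ∧
      Function.Surjective ind ∧
      Φ.toAddMonoidHom.comp (ClusterIndex.relIndex T) = ind ∧
      (∀ (X : C) (D : ClusterIndex.ApproxTower T (n - 1) X),
        Φ (ClusterIndex.RelK₀.of T X) = D.index) ∧
      (∀ Y : T.FullSubcategory,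
        Φ.symm (ClusterIndex.SplitK₀.of Y) = ClusterIndex.RelK₀.of T Y.obj) := by
  have hadd := hT.toIsAdditiveSubcategory
  have := hadd.closedUnderSummands
  have hmem : ∀ X, T X ↔ ClusterIndex.ExtVanishing T n X := fun X =>
    (hT.mem_iff_right X).trans
      ⟨fun h j h₁ h₂ => h j h₁ (by omega), fun h j h₁ h₂ => h j h₁ (by omega)⟩
  have htower : ∀ X : C, Nonempty (ClusterIndex.ApproxTower T (n - 1) X) := fun X =>
    ClusterIndex.nonempty_approxTower hmem
      (fun X => ClusterIndex.exists_isMinimalRightApprox k homFinite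
        (hT.functoriallyFinite.1 X)) (d := 1) (by omega) X (fun j h₁ h₂ => by omega)
  obtain ⟨ind, Φ, h₁, h₂, h₃⟩ := ClusterIndex.exists_index_equiv hadd
    (fun X => ⟨_, (htower X).some.hasIndex⟩)
  refine ⟨htower, ind, Φ, fun X D => h₁ X _ D.hasIndex, ?_, h₂, fun X D => ?_, h₃⟩
  · rw [← h₂]
    exact Φ.surjective.comp (QuotientAddGroup.mk'_surjective _)
  · exact (DFunLike.congr_fun h₂ _).trans (h₁ X _ D.hasIndex)
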